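/- Let $S\subseteq\mathbb N=\{0,1,2,\dots\}$ be a numerical semigroup (a submonoid of $(\mathbb N,+)$ with finite complement), minimally generated by $a_1,\dots,a_e$. Let $k$ be a field, and suppose that $S$ is a complete intersection, i.e. that the kernel of the $k$-algebra homomorphism $k[x_1,\dots,x_e]\to k[t]$, $x_i\mapsto t^{a_i}$ (whose image is $k[S]=k[t^{a_1},\dots,t^{a_e}]$) is generated by a regular sequence $f_1,\dots,f_{e-1}$ of polynomials that are homogeneous with respect to the grading $\deg x_i=a_i$. Let $F(S)=\max\{n\in\mathbb Z : n\notin S\}$ be the Frobenius number of $S$. Let $\varphi\colon\mathbb N^e\to S$, $\varphi(n_1,\dots,n_e)=n_1a_1+\dots+n_ea_e$. A minimal presentation of $S$ is a subset $\rho\subseteq\mathbb N^e\times\mathbb N^e$ that generates the congruence $\{(u,v):\varphi(u)=\varphi(v)\}$ and is minimal under inclusion with this property; for $r=(r_1,r_2)\in\rho$ put $|r|=\varphi(r_1)=\varphi(r_2)$. We say that $S$ satisfies Condition (*) if $F(S)>|r|/2$ for every minimal presentation $\rho$ of $S$ and every $r\in\rho$. Then $S$ satisfies Condition (*), except precisely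 when $e=2$ and either $2\in\{a_1,a_2\}$ or $\{a_1,a_2\}\in\{\{3,4\},\{3,5\}\}$; in these exceptional cases Condition (*) fails. -/

import Mathlib

/-- A numerical semigroup: a submonoid of `(ℕ, +)` with finite complement. -/
structure NumericalSemigroup extends AddSubmonoid ℕ where
  finite_compl : (carrierᶜ : Set ℕ).Finite

namespace NumericalSemigroup

/-- The Frobenius number `max {n ∈ ℤ | n ∉ S}`, an integer (it is `-1` for `S = ℕ`). -/
noncomputable def frobenius (S : NumericalSemigroup) : ℤ :=
  sSup {n : ℤ | ¬ ∃ s ∈ S.toAddSubmonoid, (s : ℤ) = n}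

/-- The maximum defining the Frobenius number is attained. -/
theorem isGreatest_frobenius (S : NumericalSemigroup) :
    IsGreatest {n : ℤ | ¬ ∃ s ∈ S.toAddSubmonoid, (s : ℤ) = n} S.frobenius := by
  have hne : ({n : ℤ | ¬ ∃ s ∈ S.toAddSubmonoid, (s : ℤ) = n}).Nonempty := by
    refine ⟨-1, ?_⟩
    rintro ⟨s, -, hs⟩
    omega
  have hbdd : BddAbove {n : ℤ | ¬ ∃ s ∈ S.toAddSubmonoid, (s : ℤ) = n} := by
    obtain ⟨B, hB⟩ := S.finite_compl.bddAbove
    refine ⟨B, fun n hn => ?_⟩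
    by_contra hlt
    refine hn ⟨n.toNat, ?_, by omega⟩
    by_contra hmem
    have := hB (show n.toNat ∈ (S.carrierᶜ : Set ℕ) from hmem)
    omega
  exact ⟨Int.csSup_mem hne hbdd, fun n hn => le_csSup hbdd hn⟩

/-- `S` is minimally generated by `a₁, …, aₑ`: the `aᵢ` generate `S`, and no longer do so when any
one of them is left out. (In particular the `aᵢ` are positive and distinct.) -/
def IsMinimallyGeneratedBy (S : NumericalSemigroup) {e : ℕ} (a : Fin e → ℕ) : Prop :=
  AddSubmonoid.closure (Set.range a) = S.toAddSubmonoid ∧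
    ∀ i, AddSubmonoid.closure (a '' {j | j ≠ i}) ≠ S.toAddSubmonoid

end NumericalSemigroup

section SemigroupRing

variable (k : Type*) [Field k] {e : ℕ} (a : Fin e → ℕ)

/-- The semigroup ring `k[S] = k[t^{a₁}, …, t^{aₑ}] ⊆ k[t]`, where `S` is generated by the `aᵢ`. -/
noncomputable def semigroupRing : Subalgebra k (Polynomial k) :=
  Algebra.adjoin k (Set.range fun i => (Polynomial.X : Polynomial k) ^ a i)

/-- The graded homomorphism `k[x₁, …, xₑ] → k[t]`, `xᵢ ↦ t^{aᵢ}`, where `deg xᵢ = aᵢ` and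
`deg t = 1`. -/
noncomputable def semigroupRingHom : MvPolynomial (Fin e) k →ₐ[k] Polynomial k :=
  MvPolynomial.aeval fun i => (Polynomial.X : Polynomial k) ^ a i

/-- The image of `semigroupRingHom` is `k[S]`, so `k[S]` is `k[x₁, …, xₑ]` modulo its kernel. -/
theorem range_semigroupRingHom : (semigroupRingHom k a).range = semigroupRing k a :=
  (Algebra.adjoin_range_eq_range_aeval k _).symm

/-- `k[S]` is a graded complete intersection, for `S` minimally generated by `a₁, …, aₑ`: it is
`k[x₁, …, xₑ] / (f₁, …, f_{e-1})`, where `deg xᵢ = aᵢ` and `f₁, …, f_{e-1}` is a regular sequence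
of homogeneous polynomials. -/
def IsCompleteIntersectionSemigroupRing : Prop :=
  ∃ f : Fin (e - 1) → MvPolynomial (Fin e) k,
    (∀ i, ∃ d, MvPolynomial.IsWeightedHomogeneous a (f i) d) ∧
    RingTheory.Sequence.IsRegular (MvPolynomial (Fin e) k) (List.ofFn f) ∧
    Ideal.span (Set.range f) = RingHom.ker (semigroupRingHom k a)

end SemigroupRing

/-- `ρ` generates the kernel congruence of `φ : Free(Y₁, …, Yₑ) → S`, `Yᵢ ↦ aᵢ`. Here the free
commutative monoid is `Fin e →₀ ℕ`, and `φ u = ∑ i, uᵢ aᵢ` is `Finsupp.weight a u`. -/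
def IsPresentation {e : ℕ} (a : Fin e → ℕ) (ρ : Set ((Fin e →₀ ℕ) × (Fin e →₀ ℕ))) : Prop :=
  addConGen (fun u v => (u, v) ∈ ρ) = AddCon.ker (Finsupp.weight a)

/-- A presentation that is minimal with respect to inclusion. -/
def IsMinimalPresentation {e : ℕ} (a : Fin e → ℕ)
    (ρ : Set ((Fin e →₀ ℕ) × (Fin e →₀ ℕ))) : Prop :=
  Minimal (IsPresentation a) ρ

/-- Condition (*) for a numerical semigroup `S` minimally generated by `a₁, …, aₑ`:
`F(S) > |r| / 2` for all relations `r = (r₁, r₂)` in a minimal presentation,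
where `|r| = φ(r₁) = φ(r₂)`. -/
def NumericalSemigroup.SatisfiesConditionStar (S : NumericalSemigroup) {e : ℕ}
    (a : Fin e → ℕ) : Prop :=
  ∀ ρ, IsMinimalPresentation a ρ →
    ∀ r ∈ ρ, ((Finsupp.weight a r.1 : ℕ) : ℚ) / 2 < (S.frobenius : ℚ)

/-! ### Ideals generated by variables, and Krull's height theorem -/

section SpanX

open MvPolynomial

variable {σ k : Type*} [Field k]

/-! Let `d i` be the degrees of the homogeneous generators `f i` of the kernel. Three facts carry
the proof.

Relations: if `|r|` exceeded every `d i`, the other relations would already identify all monomials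
occurring in any `f i`, so `r` would be redundant. Hence `|r| ≤ d i` for some `i`
(`IsMinimalPresentation.exists_weight_le`).

Frobenius number: comparing the Hilbert series of the complete intersection with that of `S` gives
`∏ (1 - X ^ a i) * H = ∏ (1 - X ^ d i)`, and degrees yield `∑ d ≤ F + ∑ a`
(`sum_degree_le_frobenius_add`).

Size of degrees: for a proper subset `J` of the variables, at least `#J` of the `f i` contain a
monomial in the variables of `J` only (`card_le_card_notMem_span_X`, by Krull's height theorem). By
minimality of the generators that monomial has at least two factors, so `d i ≥ 2 * min_J a`. Applied
to all thresholds, this gives `∑ d ≥ 2 * ∑ a` with the smallest generator `a j₀` left out of the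
second sum, and also `d i ≥ 2 * (a j₀ + 1)` for all `i`.

For `e ≥ 3` there is a second relation `i₁ ≠ i₀`, and `2F ≥ 2∑ d - 2∑ a ≥ ∑ d - 2 * a j₀ ≥ d i₀ + d
i₁ - 2 * a j₀ > d i₀ ≥ |r|`. For `e = 2`, `F = a 0 * a 1 - a 0 - a 1` and the relation has weight `a
0 * a 1`, so only an elementary inequality remains. For `e ≤ 1` there are no relations. -/

theorem X_mem_span_X_image_iff {s : Set σ} {j : σ} :
    (X j : MvPolynomial σ k) ∈ Ideal.span (X '' s : Set (MvPolynomial σ k)) ↔ j ∈ s := by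
  classical
  rw [mem_ideal_span_X_image]
  simp [support_X, Finsupp.single_apply]

/-- The ideal is the kernel of the substitution that kills the variables in `s`, an endomorphism of
a domain. -/
theorem isPrime_span_X_image (s : Set σ) :
    (Ideal.span (X '' s : Set (MvPolynomial σ k))).IsPrime := by
  classical
  let φ : MvPolynomial σ k →ₐ[k] MvPolynomial σ k := aeval fun i => if i ∈ s then 0 else X i
  have hφ : Ideal.span (X '' s : Set (MvPolynomial σ k)) = RingHom.ker φ := by
    apply le_antisymm
    · rw [Ideal.span_le]
      rintro _ ⟨i, hi, rfl⟩
      simp [φ, hi]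
    · intro p hp
      have h : (Ideal.Quotient.mkₐ k (Ideal.span (X '' s : Set (MvPolynomial σ k)))).comp φ =
          Ideal.Quotient.mkₐ k _ := by
        ext i
        by_cases hi : i ∈ s
        · have : (Ideal.Quotient.mk (Ideal.span (X '' s : Set (MvPolynomial σ k)))) (X i) = 0 :=
            Ideal.Quotient.eq_zero_iff_mem.2 (X_mem_span_X_image_iff.2 hi)
          simp [φ, hi, this]
        · simp [φ, hi]
      have h2 := DFunLike.congr_fun h p
      rw [RingHom.mem_ker] at hp
      rw [AlgHom.comp_apply, hp, map_zero] at h2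
      exact Ideal.Quotient.eq_zero_iff_mem.1 h2.symm
  rw [hφ]
  exact RingHom.ker_isPrime _

theorem card_le_height_span_X_image (s : Finset σ) :
    (s.card : ℕ∞) ≤ (Ideal.span (X '' (s : Set σ) : Set (MvPolynomial σ k))).height := by
  classical
  induction s using Finset.induction_on with
  | empty => simp
  | insert j s hj ih =>
    have h1 := isPrime_span_X_image (k := k) (s : Set σ)
    have h2 := isPrime_span_X_image (k := k) ((insert j s : Finset σ) : Set σ)
    rw [Finset.card_insert_of_notMem hj]
    have hlt : Ideal.span (X '' (s : Set σ) : Set (MvPolynomial σ k)) <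
        Ideal.span (X '' ((insert j s : Finset σ) : Set σ)) := by
      refine lt_of_le_of_ne (Ideal.span_mono (Set.image_mono (by simp))) fun h => ?_
      have : (X j : MvPolynomial σ k) ∈
          Ideal.span (X '' ((insert j s : Finset σ) : Set σ) : Set (MvPolynomial σ k)) :=
        X_mem_span_X_image_iff.2 (by simp)
      rw [← h, X_mem_span_X_image_iff] at this
      exact hj (by simpa using this)
    refine le_trans ?_ (Ideal.height_add_one_le_of_lt_of_isPrime hlt)
    push_cast
    gcongr

/-- An ideal primary to the irrelevant ideal of a polynomial ring in `n` variables
needs at least `n` generators. -/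
theorem card_le_of_X_pow_mem_span [Fintype σ] (T : Finset (MvPolynomial σ k))
    (hT : ∀ p ∈ T, constantCoeff p = 0)
    (hX : ∀ j, ∃ n, (X j : MvPolynomial σ k) ^ n ∈ Ideal.span (T : Set (MvPolynomial σ k))) :
    Fintype.card σ ≤ T.card := by
  classical
  have hP := isPrime_span_X_image (k := k) (Set.univ : Set σ)
  -- A prime over `T` contains a power of each variable, hence each variable; so the irrelevant
  -- ideal is minimal over `T` and Krull bounds its height by `T.card`.
  have hmin : Ideal.span (X '' (Set.univ : Set σ) : Set (MvPolynomial σ k)) ∈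
      (Ideal.span (T : Set (MvPolynomial σ k))).minimalPrimes := by
    refine ⟨⟨hP, ?_⟩, ?_⟩
    · rw [Ideal.span_le]
      intro p hp
      rw [SetLike.mem_coe, mem_ideal_span_X_image]
      intro m hm
      by_contra! h
      have : m = 0 := by ext i; simpa using h i
      subst this
      exact (mem_support_iff.1 hm) (hT p hp)
    · rintro Q ⟨hQ, hTQ⟩ -
      rw [Ideal.span_le]
      rintro _ ⟨j, -, rfl⟩
      obtain ⟨n, hn⟩ := hX j
      exact hQ.mem_of_pow_mem n (hTQ hn)
  have h1 := Ideal.height_le_card_of_mem_minimalPrimes_span_finset hmin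
  have h2 := card_le_height_span_X_image (k := k) (Finset.univ : Finset σ)
  rw [Finset.coe_univ] at h2
  exact_mod_cast h2.trans h1

end SpanX

/-! ### The kernel ideal: its monomials and its generators -/

section Kernel

open MvPolynomial

variable {k : Type*} [Field k] {e : ℕ} {a : Fin e → ℕ}

theorem NumericalSemigroup.IsMinimallyGeneratedBy.notMem_closure {S : NumericalSemigroup}
    (h : S.IsMinimallyGeneratedBy a) (i : Fin e) :
    a i ∉ AddSubmonoid.closure (a '' {j | j ≠ i}) := by
  intro hi
  refine h.2 i (le_antisymm ?_ ?_)
  · rw [← h.1]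
    exact AddSubmonoid.closure_mono (Set.image_subset_range _ _)
  · rw [← h.1, AddSubmonoid.closure_le]
    rintro _ ⟨j, rfl⟩
    by_cases hj : j = i
    · rwa [hj]
    · exact AddSubmonoid.subset_closure ⟨j, hj, rfl⟩

theorem NumericalSemigroup.IsMinimallyGeneratedBy.pos {S : NumericalSemigroup}
    (h : S.IsMinimallyGeneratedBy a) (i : Fin e) : 0 < a i := by
  by_contra! h0
  exact h.notMem_closure i (by rw [Nat.le_zero.1 h0]; exact zero_mem _)

theorem NumericalSemigroup.IsMinimallyGeneratedBy.injective {S : NumericalSemigroup}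
    (h : S.IsMinimallyGeneratedBy a) : Function.Injective a := by
  intro i j hij
  by_contra hne
  exact h.notMem_closure i (AddSubmonoid.subset_closure ⟨j, fun h => hne h.symm, hij.symm⟩)

theorem weight_mem_closure (a : Fin e → ℕ) (s : Set (Fin e)) (u : Fin e →₀ ℕ)
    (hu : ∀ j ∉ s, u j = 0) : Finsupp.weight a u ∈ AddSubmonoid.closure (a '' s) := by
  rw [Finsupp.weight_apply, Finsupp.sum]
  refine sum_mem fun j hj => nsmul_mem (AddSubmonoid.subset_closure (Set.mem_image_of_mem a ?_)) _
  by_contra hjs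
  exact (Finsupp.mem_support_iff.1 hj) (hu j hjs)

theorem mem_closure_range_iff {n : ℕ} :
    n ∈ AddSubmonoid.closure (Set.range a) ↔ ∃ u : Fin e →₀ ℕ, Finsupp.weight a u = n := by
  constructor
  · intro h
    induction h using AddSubmonoid.closure_induction with
    | mem x hx => obtain ⟨i, rfl⟩ := hx; exact ⟨Finsupp.single i 1, by simp [Finsupp.weight_single]⟩
    | zero => exact ⟨0, map_zero _⟩
    | add x y _ _ hx hy =>
      obtain ⟨u, rfl⟩ := hx
      obtain ⟨v, rfl⟩ := hy
      exact ⟨u + v, map_add _ _ _⟩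
  · rintro ⟨u, rfl⟩
    rw [← Set.image_univ]
    exact weight_mem_closure a _ u (by simp)

theorem semigroupRingHom_monomial (u : Fin e →₀ ℕ) (c : k) :
    semigroupRingHom k a (monomial u c) = Polynomial.monomial (Finsupp.weight a u) c := by
  rw [semigroupRingHom, aeval_monomial, Finsupp.weight_apply, Finsupp.prod, Finsupp.sum,
    ← Polynomial.C_mul_X_pow_eq_monomial, ← Polynomial.algebraMap_eq]
  congr 1
  rw [← Finset.prod_pow_eq_pow_sum]
  refine Finset.prod_congr rfl fun i _ => ?_
  rw [← pow_mul, smul_eq_mul, mul_comm]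

theorem semigroupRingHom_of_isWeightedHomogeneous {f : MvPolynomial (Fin e) k} {d : ℕ}
    (hf : IsWeightedHomogeneous a f d) :
    semigroupRingHom k a f = Polynomial.monomial d (∑ u ∈ f.support, f.coeff u) := by
  conv_lhs => rw [f.as_sum]
  rw [map_sum, map_sum]
  refine Finset.sum_congr rfl fun u hu => ?_
  rw [semigroupRingHom_monomial, hf (mem_support_iff.1 hu)]

theorem constantCoeff_eq_zero_of_mem_ker (ha : ∀ i, 0 < a i) {f : MvPolynomial (Fin e) k}
    (hf : f ∈ RingHom.ker (semigroupRingHom k a)) : constantCoeff f = 0 := by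
  have h : (Polynomial.constantCoeff.comp (semigroupRingHom k a).toRingHom) =
      constantCoeff := by
    ext i
    · simp [semigroupRingHom]
    · simp [semigroupRingHom, Polynomial.coeff_X_pow, (ha i).ne]
  rw [← h]
  rw [RingHom.mem_ker] at hf
  simp [hf]

/-- The coefficients of a homogeneous kernel element sum to zero, so a linear monomial `X j` is
accompanied by another monomial of weight `a j`. By positivity that one avoids `X j`, which makes `a
j` a redundant generator. -/
theorem two_le_degree_of_mem_support {S : NumericalSemigroup} (h : S.IsMinimallyGeneratedBy a)
    {f : MvPolynomial (Fin e) k} {d : ℕ} (hf : IsWeightedHomogeneous a f d)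
    (hker : f ∈ RingHom.ker (semigroupRingHom k a)) {m : Fin e →₀ ℕ} (hm : m ∈ f.support) :
    2 ≤ m.degree := by
  by_contra! hlt
  have h0 : m ≠ 0 := by
    rintro rfl
    exact (mem_support_iff.1 hm) (constantCoeff_eq_zero_of_mem_ker h.pos hker)
  have h1 : m.degree = 1 := by
    have : m.degree ≠ 0 := by rwa [Ne, Finsupp.degree_eq_zero_iff]
    omega
  obtain ⟨j, rfl⟩ : ∃ j, m = Finsupp.single j 1 := by
    obtain ⟨j, hj⟩ := Finsupp.ne_iff.1 h0
    refine ⟨j, ?_⟩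
    have hle : Finsupp.single j 1 ≤ m := by
      rw [Finsupp.single_le_iff]
      exact Nat.one_le_iff_ne_zero.2 hj
    obtain ⟨w, rfl⟩ := exists_add_of_le hle
    rw [map_add, Finsupp.degree_single, Nat.add_eq_left, Finsupp.degree_eq_zero_iff] at h1
    rw [h1, add_zero]
  have hd : d = a j := by
    rw [← hf (mem_support_iff.1 hm), Finsupp.weight_single, one_smul]
  have hsum : ∑ u ∈ f.support, f.coeff u = 0 := by
    rw [RingHom.mem_ker, semigroupRingHom_of_isWeightedHomogeneous hf] at hker
    exact (Polynomial.monomial_eq_zero_iff _ _).1 hker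
  obtain ⟨v, hv, hvm⟩ : ∃ v ∈ f.support, v ≠ Finsupp.single j 1 := by
    by_contra! hall
    rw [Finset.sum_eq_single_of_mem _ hm fun b hb hne => absurd (hall b hb) hne] at hsum
    exact (mem_support_iff.1 hm) hsum
  have hwv : Finsupp.weight a v = a j := by rw [hf (mem_support_iff.1 hv), hd]
  have := Finsupp.nonTorsionWeight_of (R := ℕ) (w := a) fun i => (h.pos i).ne'
  have hvj : v j = 0 := by
    by_contra hne
    have hle : Finsupp.single j 1 ≤ v := by
      rw [Finsupp.single_le_iff]; omega
    obtain ⟨w, rfl⟩ := exists_add_of_le hle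
    rw [map_add, Finsupp.weight_single, one_smul, Nat.add_eq_left,
      Finsupp.weight_eq_zero_iff_eq_zero a] at hwv
    · subst hwv; simp at hvm
  have := weight_mem_closure a {i | i ≠ j} v (by simpa using hvj)
  rw [hwv] at this
  exact h.notMem_closure j this

theorem two_mul_le_of_notMem_span_X {S : NumericalSemigroup} (h : S.IsMinimallyGeneratedBy a)
    {f : MvPolynomial (Fin e) k} {d : ℕ} (hf : IsWeightedHomogeneous a f d)
    (hker : f ∈ RingHom.ker (semigroupRingHom k a)) {J : Finset (Fin e)} {c : ℕ}
    (hc : ∀ j ∈ J, c ≤ a j)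
    (hJ : f ∉ Ideal.span (X '' ((Jᶜ : Finset (Fin e)) : Set (Fin e)) : Set (MvPolynomial _ k))) :
    2 * c ≤ d := by
  rw [mem_ideal_span_X_image] at hJ
  push Not at hJ
  obtain ⟨m, hm, hmJ⟩ := hJ
  have h2 := two_le_degree_of_mem_support h hf hker hm
  rw [← hf (mem_support_iff.1 hm), Finsupp.weight_apply, Finsupp.sum]
  rw [Finsupp.degree_apply] at h2
  calc 2 * c ≤ (∑ i ∈ m.support, m i) * c := Nat.mul_le_mul_right _ h2
    _ = ∑ i ∈ m.support, m i * c := Finset.sum_mul ..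
    _ ≤ _ := by
      refine Finset.sum_le_sum fun i hi => Nat.mul_le_mul_left _ (hc i ?_)
      by_contra hiJ
      exact (Finsupp.mem_support_iff.1 hi) (hmJ i (by simpa using hiJ))

open Classical in
/-- At least `#J` of the generators of the kernel involve a monomial in the variables of `J`. -/
theorem card_le_card_notMem_span_X (ha : ∀ i, 0 < a i) {ι : Type*} [Fintype ι]
    {f : ι → MvPolynomial (Fin e) k}
    (hspan : Ideal.span (Set.range f) = RingHom.ker (semigroupRingHom k a))
    {J : Finset (Fin e)} {j₀ : Fin e} (hj₀ : j₀ ∉ J) :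
    J.card ≤ (Finset.univ.filter fun i => f i ∉
      Ideal.span (X '' ((Jᶜ : Finset (Fin e)) : Set (Fin e)) : Set (MvPolynomial _ k))).card := by
  set I : Finset ι := Finset.univ.filter fun i => f i ∉
      Ideal.span (X '' ((Jᶜ : Finset (Fin e)) : Set (Fin e)) : Set (MvPolynomial _ k)) with hI
  -- `T` generates an ideal primary to the irrelevant one, so it has at least `e` elements, at most
  -- `e - J.card` of which are variables.
  let T : Finset (MvPolynomial (Fin e) k) := Jᶜ.image X ∪ I.image f
  have hXT : Ideal.span (X '' ((Jᶜ : Finset (Fin e)) : Set (Fin e)) : Set (MvPolynomial _ k)) ≤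
      Ideal.span (T : Set (MvPolynomial (Fin e) k)) := Ideal.span_mono (by simp [T])
  have hfT : ∀ i, f i ∈ Ideal.span (T : Set (MvPolynomial (Fin e) k)) := by
    intro i
    by_cases hi : i ∈ I
    · exact Ideal.subset_span (by
        rw [Finset.mem_coe, Finset.mem_union]
        exact Or.inr (Finset.mem_image_of_mem _ hi))
    · exact hXT (by simpa [hI] using hi)
  have hker : RingHom.ker (semigroupRingHom k a) ≤
      Ideal.span (T : Set (MvPolynomial (Fin e) k)) := by
    rw [← hspan, Ideal.span_le]
    rintro _ ⟨i, rfl⟩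
    exact hfT i
  have key := card_le_of_X_pow_mem_span T ?_ ?_
  · have h1 : T.card ≤ (e - J.card) + I.card := by
      refine (Finset.card_union_le _ _).trans (add_le_add ?_ Finset.card_image_le)
      refine Finset.card_image_le.trans ?_
      rw [Finset.card_compl, Fintype.card_fin]
    have h2 : J.card ≤ e := by simpa using J.card_le_univ
    rw [Fintype.card_fin] at key
    omega
  · intro p hp
    rw [Finset.mem_union, Finset.mem_image, Finset.mem_image] at hp
    rcases hp with ⟨j, -, rfl⟩ | ⟨i, -, rfl⟩
    · exact constantCoeff_X ..
    · refine constantCoeff_eq_zero_of_mem_ker ha ?_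
      rw [← hspan]
      exact Ideal.subset_span ⟨i, rfl⟩
  · intro j
    -- The binomial `X j ^ a j₀ - X j₀ ^ a j` lies in the kernel, and `X j₀` lies in `T` because `j₀
    -- ∉ J`.
    refine ⟨a j₀, ?_⟩
    have h1 : (X j ^ a j₀ - X j₀ ^ a j : MvPolynomial (Fin e) k) ∈
        Ideal.span (T : Set (MvPolynomial (Fin e) k)) := by
      apply hker
      rw [RingHom.mem_ker]
      simp [semigroupRingHom, ← pow_mul, mul_comm]
    have h2 : (X j₀ ^ a j : MvPolynomial (Fin e) k) ∈
        Ideal.span (T : Set (MvPolynomial (Fin e) k)) :=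
      Ideal.pow_mem_of_mem _ (hXT (X_mem_span_X_image_iff.2 (by simpa using hj₀))) _ (ha j)
    simpa using add_mem h1 h2

end Kernel

/-! ### Hilbert series of weighted graded quotients -/

section HilbertSeries

open MvPolynomial

variable {σ k : Type*} [Field k]

/-- The weighted homogeneous elements of degree `n` in an ideal of a polynomial ring. -/
noncomputable def weightedPart (w : σ → ℕ) (I : Ideal (MvPolynomial σ k)) (n : ℕ) :
    Submodule k (MvPolynomial σ k) :=
  I.restrictScalars k ⊓ weightedHomogeneousSubmodule k w n

theorem mem_weightedPart {w : σ → ℕ} {I : Ideal (MvPolynomial σ k)} {n : ℕ}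
    {p : MvPolynomial σ k} : p ∈ weightedPart w I n ↔ p ∈ I ∧ IsWeightedHomogeneous w p n :=
  Iff.rfl

/-- The Hilbert series of `k[x] ⧸ I` with respect to the grading `deg xᵢ = wᵢ`. -/
noncomputable def hilbertSeries (w : σ → ℕ) (I : Ideal (MvPolynomial σ k)) : PowerSeries ℤ :=
  PowerSeries.mk fun n => (Module.finrank k (weightedHomogeneousSubmodule k w n) : ℤ) -
    Module.finrank k (weightedPart w I n)

theorem finiteDimensional_weightedHomogeneousSubmodule [Finite σ] {w : σ → ℕ}
    (hw : ∀ i, 0 < w i) (n : ℕ) : FiniteDimensional k (weightedHomogeneousSubmodule k w n) :=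
  Module.Finite.iff_fg.2 (weightedHomogeneousSubmodule_fg k w (fun i => (hw i).ne') n)

theorem finiteDimensional_weightedPart [Finite σ] {w : σ → ℕ}
    (hw : ∀ i, 0 < w i) (I : Ideal (MvPolynomial σ k)) (n : ℕ) :
    FiniteDimensional k (weightedPart w I n) := by
  have := finiteDimensional_weightedHomogeneousSubmodule (k := k) hw n
  exact Submodule.finiteDimensional_of_le (inf_le_right : weightedPart w I n ≤ _)

theorem weightedHomogeneousComponent_mul_of_right {w : σ → ℕ} {f : MvPolynomial σ k} {d : ℕ}
    (hf : IsWeightedHomogeneous w f d) (g : MvPolynomial σ k) (n : ℕ) :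
    weightedHomogeneousComponent w n (g * f) =
      if d ≤ n then weightedHomogeneousComponent w (n - d) g * f else 0 := by
  let _ := weightedGradedAlgebra k w
  have h : ∀ (p : MvPolynomial σ k) m, weightedHomogeneousComponent w m p =
      (DirectSum.decompose (weightedHomogeneousSubmodule k w) p m : MvPolynomial σ k) :=
    fun p m => (weightedDecomposition.decompose'_apply k w p m).symm
  rw [h, h]
  exact DirectSum.coe_decompose_mul_of_right_mem _ n hf

/-- Closure of an ideal under taking weighted homogeneous components. -/
def IsComponentClosed (w : σ → ℕ) (I : Ideal (MvPolynomial σ k)) : Prop :=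
  ∀ p ∈ I, ∀ n, weightedHomogeneousComponent w n p ∈ I

theorem isComponentClosed_span {w : σ → ℕ} {T : Set (MvPolynomial σ k)}
    (hT : ∀ f ∈ T, ∃ d, IsWeightedHomogeneous w f d) : IsComponentClosed w (Ideal.span T) := by
  intro p hp n
  induction hp using Submodule.span_induction with
  | mem f hf =>
    obtain ⟨d, hd⟩ := hT f hf
    have := weightedHomogeneousComponent_mul_of_right hd 1 n
    rw [one_mul] at this
    rw [this]
    split_ifs
    · exact Ideal.mul_mem_left _ _ (Ideal.subset_span hf)
    · exact zero_mem _
  | zero => rw [map_zero]; exact zero_mem _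
  | add f g _ _ hf hg => rw [map_add]; exact add_mem hf hg
  | smul c f hfT hf =>
    -- A second induction with `c` arbitrary reduces to multiples of a single homogeneous generator.
    clear hf
    induction hfT using Submodule.span_induction generalizing c with
    | mem f hf =>
      obtain ⟨d, hd⟩ := hT f hf
      rw [smul_eq_mul, weightedHomogeneousComponent_mul_of_right hd]
      split_ifs
      · exact Ideal.mul_mem_left _ _ (Ideal.subset_span hf)
      · exact zero_mem _
    | zero => rw [smul_zero, map_zero]; exact zero_mem _
    | add f g _ _ hf hg => rw [smul_add, map_add]; exact add_mem (hf c) (hg c)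
    | smul b f _ hf => rw [smul_smul]; exact hf (c * b)

/-- In degree `n ≥ d` the new ideal is the sum of `I` and the multiples of `f`; regularity
identifies their intersection with `f` times the degree `n - d` part of `I`, and dimensions are
counted. -/
theorem hilbertSeries_sup_span_singleton [Finite σ] {w : σ → ℕ} (hw : ∀ i, 0 < w i)
    {I : Ideal (MvPolynomial σ k)} (hI : IsComponentClosed w I)
    {f : MvPolynomial σ k} {d : ℕ} (hf : IsWeightedHomogeneous w f d)
    (hf0 : f ≠ 0) (hreg : ∀ g, g * f ∈ I → g ∈ I) :
    hilbertSeries w (I ⊔ Ideal.span {f}) = (1 - PowerSeries.X ^ d) * hilbertSeries w I := by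
  ext n
  rw [sub_mul, one_mul, map_sub, PowerSeries.coeff_X_pow_mul']
  simp only [hilbertSeries, PowerSeries.coeff_mk]
  have hdecomp : ∀ p ∈ weightedPart w (I ⊔ Ideal.span {f}) n, ∃ q ∈ I, ∃ g,
      IsWeightedHomogeneous w q n ∧ p = q + weightedHomogeneousComponent w n (g * f) := by
    rintro p ⟨hp, hpn⟩
    obtain ⟨q, hq, r, hr, rfl⟩ := Submodule.mem_sup.1 hp
    obtain ⟨g, rfl⟩ := Ideal.mem_span_singleton'.1 hr
    refine ⟨_, hI q hq n, g, weightedHomogeneousComponent_mem w q n, ?_⟩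
    rw [← map_add]
    exact (IsWeightedHomogeneous.weightedHomogeneousComponent_same hpn).symm
  split_ifs with hdn
  · let μ : MvPolynomial σ k →ₗ[k] MvPolynomial σ k := LinearMap.mulRight k f
    have hμ : Function.Injective μ := fun x y hxy => mul_right_cancel₀ hf0 hxy
    have hsup : weightedPart w (I ⊔ Ideal.span {f}) n =
        weightedPart w I n ⊔ (weightedHomogeneousSubmodule k w (n - d)).map μ := by
      apply le_antisymm
      · intro p hp
        obtain ⟨q, hq, g, hqn, rfl⟩ := hdecomp p hp
        rw [weightedHomogeneousComponent_mul_of_right hf, if_pos hdn]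
        exact Submodule.add_mem_sup ⟨hq, hqn⟩
          ⟨_, weightedHomogeneousComponent_mem _ _ _, rfl⟩
      · refine sup_le (inf_le_inf_right _ fun x hx => Ideal.mem_sup_left hx) ?_
        rintro _ ⟨g, hg, rfl⟩
        refine ⟨Ideal.mem_sup_right (Ideal.mem_span_singleton'.2 ⟨g, rfl⟩), ?_⟩
        have := IsWeightedHomogeneous.mul hg hf
        rwa [Nat.sub_add_cancel hdn] at this
    have hinf : weightedPart w I n ⊓ (weightedHomogeneousSubmodule k w (n - d)).map μ =
        (weightedPart w I (n - d)).map μ := by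
      apply le_antisymm
      · rintro _ ⟨⟨hI', -⟩, g, hg, rfl⟩
        exact ⟨g, ⟨hreg g hI', hg⟩, rfl⟩
      · rintro _ ⟨g, ⟨hgI, hg⟩, rfl⟩
        refine ⟨⟨Ideal.mul_mem_right _ _ hgI, ?_⟩, g, hg, rfl⟩
        have := IsWeightedHomogeneous.mul hg hf
        rwa [Nat.sub_add_cancel hdn] at this
    have := finiteDimensional_weightedPart (k := k) hw I n
    have := finiteDimensional_weightedHomogeneousSubmodule (k := k) hw (n - d)
    have key := Submodule.finrank_sup_add_finrank_inf_eq (weightedPart w I n)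
      ((weightedHomogeneousSubmodule k w (n - d)).map μ)
    rw [← hsup, hinf, ← (Submodule.equivMapOfInjective μ hμ _).finrank_eq,
      ← (Submodule.equivMapOfInjective μ hμ _).finrank_eq] at key
    omega
  · have : weightedPart w (I ⊔ Ideal.span {f}) n = weightedPart w I n := by
      apply le_antisymm
      · intro p hp
        obtain ⟨q, hq, g, hqn, rfl⟩ := hdecomp p hp
        rw [weightedHomogeneousComponent_mul_of_right hf, if_neg hdn, add_zero]
        exact ⟨hq, hqn⟩
      · exact inf_le_inf_right _ fun x hx => Ideal.mem_sup_left hx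
    rw [this, sub_zero]

theorem hilbertSeries_span_range_of_regular [Finite σ] {w : σ → ℕ} (hw : ∀ i, 0 < w i) {n : ℕ}
    (f : Fin n → MvPolynomial σ k) (d : Fin n → ℕ)
    (hf : ∀ i, IsWeightedHomogeneous w (f i) (d i)) (hf0 : ∀ i, f i ≠ 0)
    (hreg : ∀ i g, g * f i ∈ Ideal.span (f '' {j | j < i}) → g ∈ Ideal.span (f '' {j | j < i})) :
    hilbertSeries w (Ideal.span (Set.range f)) =
      (∏ i, (1 - PowerSeries.X ^ d i)) * hilbertSeries w (⊥ : Ideal (MvPolynomial σ k)) := by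
  induction n with
  | zero =>
    rw [Set.range_eq_empty, Ideal.span_empty, Fin.prod_univ_zero, one_mul]
  | succ n ih =>
    have himg : ∀ i : Fin n, f '' {j | j < i.castSucc} =
        (fun i : Fin n => f i.castSucc) '' {j | j < i} := by
      intro i
      ext x
      constructor
      · rintro ⟨j, hj, rfl⟩
        have hj' : j < i.castSucc := hj
        obtain ⟨j, rfl⟩ := Fin.exists_castSucc_eq.2 (hj'.trans (Fin.castSucc_lt_last i)).ne
        exact ⟨j, Fin.castSucc_lt_castSucc_iff.1 hj', rfl⟩
      · rintro ⟨j, hj, rfl⟩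
        exact ⟨j.castSucc, Fin.castSucc_lt_castSucc_iff.2 hj, rfl⟩
    have hlast : f '' {j | j < Fin.last n} = Set.range fun i : Fin n => f i.castSucc := by
      ext x
      constructor
      · rintro ⟨j, hj, rfl⟩
        have hj' : j < Fin.last n := hj
        obtain ⟨j, rfl⟩ := Fin.exists_castSucc_eq.2 hj'.ne
        exact ⟨j, rfl⟩
      · rintro ⟨j, rfl⟩
        exact ⟨j.castSucc, Fin.castSucc_lt_last j, rfl⟩
    have hrange : Set.range f = (Set.range fun i : Fin n => f i.castSucc) ∪ {f (Fin.last n)} := by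
      rw [← hlast]
      ext x
      constructor
      · rintro ⟨j, rfl⟩
        rcases (Fin.le_last j).eq_or_lt with rfl | hj
        · exact Or.inr rfl
        · exact Or.inl ⟨j, hj, rfl⟩
      · rintro (⟨j, -, rfl⟩ | rfl) <;> exact ⟨_, rfl⟩
    have ih' := ih (fun i => f i.castSucc) (fun i => d i.castSucc) (fun i => hf _)
      (fun i => hf0 _) fun i => by
        have := hreg i.castSucc
        rwa [himg] at this
    have hr := hreg (Fin.last n)
    rw [hlast] at hr
    rw [hrange, Ideal.span_union, hilbertSeries_sup_span_singleton hw
      (isComponentClosed_span (by rintro _ ⟨i, rfl⟩; exact ⟨_, hf _⟩)) (hf _) (hf0 _) hr, ih',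
      Fin.prod_univ_castSucc]
    ring

theorem hilbertSeries_span_X {e : ℕ} {a : Fin e → ℕ} (ha : ∀ i, 0 < a i) :
    hilbertSeries a (Ideal.span (Set.range (X : Fin e → MvPolynomial (Fin e) k))) = 1 := by
  ext n
  have hmem : ∀ p : MvPolynomial (Fin e) k,
      p ∈ Ideal.span (Set.range (X : Fin e → MvPolynomial (Fin e) k)) ↔ p.coeff 0 = 0 := by
    intro p
    rw [← Set.image_univ, mem_ideal_span_X_image]
    constructor
    · intro h
      by_contra h0
      obtain ⟨i, -, hi⟩ := h 0 (mem_support_iff.2 h0)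
      exact hi rfl
    · intro h m hm
      by_contra! hall
      have : m = 0 := by ext i; simpa using hall i
      exact (mem_support_iff.1 hm) (this ▸ h)
  have := Finsupp.nonTorsionWeight_of (R := ℕ) (w := a) fun i => (ha i).ne'
  rw [hilbertSeries, PowerSeries.coeff_mk, PowerSeries.coeff_one]
  split_ifs with hn
  · subst hn
    have h1 : weightedPart a (Ideal.span (Set.range (X : Fin e → MvPolynomial (Fin e) k))) 0 =
        ⊥ := by
      rw [eq_bot_iff]
      rintro p ⟨hp, hp0⟩
      rw [Submodule.mem_bot]
      ext m
      rw [coeff_zero]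
      by_contra hm
      have : m = 0 := (Finsupp.weight_eq_zero_iff_eq_zero a).1 (hp0 hm)
      exact hm (this ▸ (hmem p).1 hp)
    have h2 : weightedHomogeneousSubmodule k a 0 =
        Submodule.span k {(1 : MvPolynomial (Fin e) k)} := by
      apply le_antisymm
      · intro p hp
        refine Submodule.mem_span_singleton.2 ⟨p.coeff 0, ?_⟩
        ext m
        rw [coeff_smul, coeff_one, smul_eq_mul]
        split_ifs with hm
        · rw [← hm, mul_one]
        · rw [mul_zero]
          by_contra hne
          exact hm ((Finsupp.weight_eq_zero_iff_eq_zero a).1 (hp fun h => hne h.symm)).symm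
      · rw [Submodule.span_singleton_le_iff_mem]
        exact isWeightedHomogeneous_one k a
    rw [h1, h2, finrank_bot, finrank_span_singleton one_ne_zero]
    rfl
  · have h1 : weightedPart a (Ideal.span (Set.range (X : Fin e → MvPolynomial (Fin e) k))) n =
        weightedHomogeneousSubmodule k a n := by
      refine inf_eq_right.2 fun p hp => (hmem p).2 ?_
      by_contra h0
      exact hn ((hp h0).symm.trans (map_zero _))
    rw [h1, sub_self]

/-- The variables themselves form a regular sequence with quotient `k`, which gives the series of
the polynomial ring without counting monomials. -/
theorem prod_one_sub_X_pow_mul_hilbertSeries_bot {e : ℕ} {a : Fin e → ℕ} (ha : ∀ i, 0 < a i) :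
    (∏ i, (1 - PowerSeries.X ^ a i)) *
      hilbertSeries a (⊥ : Ideal (MvPolynomial (Fin e) k)) = 1 := by
  rw [← hilbertSeries_span_range_of_regular ha X a (fun i => isWeightedHomogeneous_X k a i)
    (fun i => X_ne_zero i), hilbertSeries_span_X ha]
  intro i g hg
  have := isPrime_span_X_image (k := k) {j : Fin e | j < i}
  refine (this.mem_or_mem hg).resolve_right fun h => ?_
  rw [X_mem_span_X_image_iff] at h
  exact lt_irrefl i h

open Classical in
-- In degree `n` the map to `k[t]` is a functional `L` (the coefficient of `t ^ n`), nonzero exactly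
-- when some monomial has weight `n`.
theorem hilbertSeries_ker {e : ℕ} {a : Fin e → ℕ} (ha : ∀ i, 0 < a i) :
    hilbertSeries a (RingHom.ker (semigroupRingHom k a)) =
      PowerSeries.mk fun n => if n ∈ AddSubmonoid.closure (Set.range a) then 1 else 0 := by
  ext n
  rw [hilbertSeries, PowerSeries.coeff_mk, PowerSeries.coeff_mk]
  have := finiteDimensional_weightedHomogeneousSubmodule (k := k) ha n
  let L : weightedHomogeneousSubmodule k a n →ₗ[k] k :=
    (Polynomial.lcoeff k n).comp
      ((semigroupRingHom k a).toLinearMap.comp (weightedHomogeneousSubmodule k a n).subtype)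
  have hL : ∀ p : weightedHomogeneousSubmodule k a n, semigroupRingHom k a p.1 =
      Polynomial.monomial n (L p) := by
    intro p
    have := semigroupRingHom_of_isWeightedHomogeneous (k := k) p.2
    simp [L, this]
  have hker : (LinearMap.ker L).map (weightedHomogeneousSubmodule k a n).subtype =
      weightedPart a (RingHom.ker (semigroupRingHom k a)) n := by
    ext p
    rw [mem_weightedPart]
    constructor
    · rintro ⟨q, hq, rfl⟩
      refine ⟨?_, q.2⟩
      rw [RingHom.mem_ker, Submodule.subtype_apply, hL, (LinearMap.mem_ker.1 hq), map_zero]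
    · rintro ⟨hp, hpn⟩
      refine ⟨⟨p, hpn⟩, ?_, rfl⟩
      rw [RingHom.mem_ker] at hp
      simp [L, hp]
  have hfin : Module.finrank k (weightedPart a (RingHom.ker (semigroupRingHom k a)) n) =
      Module.finrank k (LinearMap.ker L) := by
    rw [← hker]
    exact ((Submodule.equivMapOfInjective _ (Submodule.subtype_injective _) _).finrank_eq).symm
  have hrk := LinearMap.finrank_range_add_finrank_ker L
  have hrange : Module.finrank k (LinearMap.range L) =
      if n ∈ AddSubmonoid.closure (Set.range a) then 1 else 0 := by
    split_ifs with hn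
    · obtain ⟨u, hu⟩ := mem_closure_range_iff.1 hn
      have hone : L ⟨monomial u 1, isWeightedHomogeneous_monomial a u 1 hu⟩ = 1 := by
        simp [L, semigroupRingHom_monomial, hu]
      have : LinearMap.range L = ⊤ := by
        rw [LinearMap.range_eq_top]
        intro c
        exact ⟨c • ⟨monomial u 1, isWeightedHomogeneous_monomial a u 1 hu⟩, by
          rw [map_smul, hone, smul_eq_mul, mul_one]⟩
      rw [this, finrank_top, Module.finrank_self]
    · have : LinearMap.range L = ⊥ := by
        rw [LinearMap.range_eq_bot]
        ext ⟨p, hp⟩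
        have : p = 0 := by
          ext u
          by_contra hne
          exact hn (mem_closure_range_iff.2 ⟨u, hp hne⟩)
        subst this
        simp [L]
      rw [this, finrank_bot]
  rw [hfin, ← hrk, hrange]
  push_cast
  ring

theorem mem_span_of_isRegular {R : Type*} [CommRing R] {n : ℕ} {f : Fin n → R}
    (h : RingTheory.Sequence.IsRegular R (List.ofFn f)) (i : Fin n) (g : R)
    (hg : g * f i ∈ Ideal.span (f '' {j | j < i})) : g ∈ Ideal.span (f '' {j | j < i}) := by
  have hi : (i : ℕ) < (List.ofFn f).length := by simp
  have h1 := h.regular_mod_prev i hi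
  have h2 : (Ideal.ofList ((List.ofFn f).take i) • ⊤ : Submodule R R) =
      Ideal.span (f '' {j | j < i}) := by
    rw [smul_eq_mul, Ideal.mul_top, Ideal.ofList]
    congr 1
    ext x
    simp only [Set.mem_ofPred_eq, List.mem_take_iff_getElem, Set.mem_image, List.getElem_ofFn]
    constructor
    · rintro ⟨j, hj, rfl⟩
      exact ⟨⟨j, _⟩, (lt_min_iff.1 hj).1, rfl⟩
    · rintro ⟨j, hj, rfl⟩
      exact ⟨j, by simpa using hj, rfl⟩
  rw [h2, List.getElem_ofFn] at h1
  rw [← Submodule.Quotient.mk_eq_zero] at hg ⊢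
  apply h1
  change f i • _ = f i • _
  rw [smul_zero, ← hg, ← Submodule.Quotient.mk_smul, smul_eq_mul, mul_comm]

theorem ne_zero_of_isRegular {R : Type*} [CommRing R] {n : ℕ} {f : Fin n → R}
    (h : RingTheory.Sequence.IsRegular R (List.ofFn f)) (i : Fin n) : f i ≠ 0 := by
  intro h0
  have h1 := mem_span_of_isRegular h i 1 (by rw [h0, mul_zero]; exact zero_mem _)
  refine h.top_ne_smul (top_le_iff.1 ?_).symm
  rw [smul_eq_mul, Ideal.mul_top, ← (Ideal.eq_top_iff_one _).2 h1, Ideal.ofList]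
  refine Ideal.span_mono ?_
  rintro _ ⟨j, -, rfl⟩
  simp

end HilbertSeries

/-! ### Degrees of the relations and the Frobenius number -/

section Frobenius

open Polynomial in
/-- For a complete intersection, the degrees of the relations sum up to at most the Frobenius
number plus the sum of the generators. -/
theorem sum_degree_le_frobenius_add {k : Type*} [Field k] (S : NumericalSemigroup) {e n : ℕ}
    {a : Fin e → ℕ} (ha : ∀ i, 0 < a i)
    (hS : AddSubmonoid.closure (Set.range a) = S.toAddSubmonoid)
    (f : Fin n → MvPolynomial (Fin e) k) (d : Fin n → ℕ)
    (hf : ∀ i, MvPolynomial.IsWeightedHomogeneous a (f i) (d i)) (hd : ∀ i, 0 < d i)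
    (hreg : RingTheory.Sequence.IsRegular (MvPolynomial (Fin e) k) (List.ofFn f))
    (hspan : Ideal.span (Set.range f) = RingHom.ker (semigroupRingHom k a)) :
    ((∑ i, d i : ℕ) : ℤ) ≤ S.frobenius + ((∑ i, a i : ℕ) : ℤ) := by
  classical
  have hF := S.isGreatest_frobenius
  have hF1 : -1 ≤ S.frobenius := hF.2 (by rintro ⟨s, -, hs⟩; omega)
  obtain ⟨N, hN⟩ : ∃ N : ℕ, (N : ℤ) = S.frobenius + 1 := ⟨(S.frobenius + 1).toNat, by omega⟩
  have hmem : ∀ m, N ≤ m → m ∈ AddSubmonoid.closure (Set.range a) := by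
    intro m hm
    by_contra hnot
    rw [hS] at hnot
    have := hF.2 (show (m : ℤ) ∈ _ from by
      rintro ⟨s, hs, hsm⟩
      exact hnot ((by exact_mod_cast hsm : s = m) ▸ hs))
    omega
  let H : PowerSeries ℤ :=
    PowerSeries.mk fun n => if n ∈ AddSubmonoid.closure (Set.range a) then 1 else 0
  have hH : (∏ i, (1 - PowerSeries.X ^ a i)) * H = ∏ i, (1 - PowerSeries.X ^ d i) := by
    have h1 := hilbertSeries_span_range_of_regular ha f d hf (ne_zero_of_isRegular hreg)
      (mem_span_of_isRegular hreg)
    rw [hspan, hilbertSeries_ker ha] at h1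
    change H = _ at h1
    rw [h1, mul_left_comm, prod_one_sub_X_pow_mul_hilbertSeries_bot ha, mul_one]
  -- From the conductor `N = F + 1` on, `H` is a geometric tail, so `(1 - X) * H` is a polynomial
  -- `Q` of degree at most `N`. The extra factor `1 - X` on the other side compensates for the `1`
  -- in `N`.
  let G : ℤ[X] := ∑ m ∈ Finset.range N, C (PowerSeries.coeff m H) * X ^ m
  let Q : ℤ[X] := (1 - X) * G + X ^ N
  have hQ : (Q : PowerSeries ℤ) = (1 - PowerSeries.X) * H := by
    have hG : H = (G : PowerSeries ℤ) + PowerSeries.X ^ N * PowerSeries.mk (1 : ℕ → ℤ) := by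
      ext m
      rw [map_add, PowerSeries.coeff_X_pow_mul', Polynomial.coeff_coe]
      simp only [G, Polynomial.finsetSum_coeff, Polynomial.coeff_C_mul, Polynomial.coeff_X_pow]
      by_cases hm : N ≤ m
      · rw [if_pos hm, Finset.sum_eq_zero]
        · simp [H, hmem m hm]
        · intro x hx
          rw [if_neg (by have := Finset.mem_range.1 hx; omega), mul_zero]
      · rw [if_neg hm]
        simp [not_le.1 hm]
    have hgeom : (1 - PowerSeries.X) * (PowerSeries.mk 1 : PowerSeries ℤ) = 1 := by
      rw [mul_comm]; exact PowerSeries.mk_one_mul_one_sub_eq_one ℤ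
    rw [hG, mul_add, mul_left_comm, hgeom]
    simp [Q]
  have hpoly : (∏ i, (1 - X ^ a i)) * Q = (1 - X) * ∏ i, (1 - X ^ d i : ℤ[X]) := by
    apply Polynomial.coe_injective
    have hcoe : ∀ {m : ℕ} (b : Fin m → ℕ), ((∏ i, (1 - X ^ b i : ℤ[X]) : ℤ[X]) : PowerSeries ℤ) =
        ∏ i, (1 - PowerSeries.X ^ b i) := by
      intro m b
      rw [← Polynomial.coeToPowerSeries.ringHom_apply, map_prod]
      simp
    rw [Polynomial.coe_mul, Polynomial.coe_mul, hcoe, hcoe, hQ, mul_left_comm, hH]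
    simp
  have hdeg1 : ∀ m : ℕ, (1 - X ^ m : ℤ[X]).natDegree ≤ m := fun m => by
    refine (natDegree_sub_le _ _).trans ?_
    simp
  have hdegd : ∀ m : ℕ, 0 < m → (1 - X ^ m : ℤ[X]).natDegree = m := fun m hm => by
    rw [← neg_sub, natDegree_neg, ← C_1, natDegree_X_pow_sub_C]
  have hned : ∀ m : ℕ, 0 < m → (1 - X ^ m : ℤ[X]) ≠ 0 := fun m hm h => by
    have := hdegd m hm
    rw [h, natDegree_zero] at this
    omega
  have hGdeg : G.natDegree + 1 ≤ N ∨ G = 0 := by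
    rcases Nat.eq_zero_or_pos N with h0 | h0
    · right; simp [G, h0]
    · left
      have : G.natDegree ≤ N - 1 := by
        refine natDegree_sum_le_of_forall_le _ _ fun m hm => ?_
        refine (natDegree_C_mul_X_pow_le _ _).trans ?_
        have := Finset.mem_range.1 hm
        omega
      omega
  have hQdeg : Q.natDegree ≤ N := by
    refine (natDegree_add_le _ _).trans (max_le ?_ (natDegree_X_pow_le _))
    rcases hGdeg with h | h
    · refine natDegree_mul_le.trans ?_
      have := hdeg1 1
      rw [pow_one] at this
      omega
    · simp [h]
  have hlhs : ((∏ i, (1 - X ^ a i)) * Q).natDegree ≤ ∑ i, a i + N := by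
    refine natDegree_mul_le.trans (add_le_add ?_ hQdeg)
    exact (natDegree_prod_le _ _).trans (Finset.sum_le_sum fun i _ => hdeg1 _)
  have hrhs : ((1 - X) * ∏ i, (1 - X ^ d i : ℤ[X])).natDegree = 1 + ∑ i, d i := by
    have h1 := hdegd 1 one_pos
    have h2 := hned 1 one_pos
    rw [pow_one] at h1 h2
    rw [natDegree_mul h2 (Finset.prod_ne_zero_iff.2 fun i _ => hned _ (hd i)), h1,
      natDegree_prod _ _ fun i _ => hned _ (hd i)]
    congr 1
    exact Finset.sum_congr rfl fun i _ => hdegd _ (hd i)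
  rw [hpoly, hrhs] at hlhs
  omega

end Frobenius

/-! ### Minimal presentations versus generators of the kernel ideal -/

section Presentation

open MvPolynomial

variable {k : Type*} [Field k] {e : ℕ} {a : Fin e → ℕ}
  {ρ : Set ((Fin e →₀ ℕ) × (Fin e →₀ ℕ))}

theorem IsPresentation.weight_eq (h : IsPresentation a ρ) {r : (Fin e →₀ ℕ) × (Fin e →₀ ℕ)}
    (hr : r ∈ ρ) : Finsupp.weight a r.1 = Finsupp.weight a r.2 := by
  have h1 : addConGen (fun u v => (u, v) ∈ ρ) r.1 r.2 := AddConGen.Rel.of _ _ hr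
  rw [h] at h1
  exact h1

/-- In weight less than that of a relation `r`, the relation `r` is not needed. -/
theorem IsPresentation.addConGen_diff_of_weight_lt (h : IsPresentation a ρ)
    {r : (Fin e →₀ ℕ) × (Fin e →₀ ℕ)} {u v : Fin e →₀ ℕ}
    (huv : Finsupp.weight a u = Finsupp.weight a v)
    (hlt : Finsupp.weight a u < Finsupp.weight a r.1) :
    addConGen (fun u v => (u, v) ∈ ρ \ {r}) u v := by
  -- `D` is compatible with addition because the summands of a sum of weight below `|r|` also have
  -- weight below `|r|`; it contains `ρ` because `r` itself is not below that bound.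
  let D : AddCon (Fin e →₀ ℕ) :=
    { r := fun u v => Finsupp.weight a u = Finsupp.weight a v ∧
        (Finsupp.weight a u < Finsupp.weight a r.1 →
          addConGen (fun u v => (u, v) ∈ ρ \ {r}) u v)
      iseqv :=
        { refl := fun u => ⟨rfl, fun _ => AddCon.refl _ _⟩
          symm := fun h => ⟨h.1.symm, fun hw => AddCon.symm _ (h.2 (h.1 ▸ hw))⟩
          trans := fun h₁ h₂ => ⟨h₁.1.trans h₂.1, fun hw =>
            AddCon.trans _ (h₁.2 hw) (h₂.2 (h₁.1 ▸ hw))⟩ }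
      add' := by
        intro u v u' v' h₁ h₂
        refine ⟨by rw [map_add, map_add, h₁.1, h₂.1], fun hw => ?_⟩
        rw [map_add] at hw
        exact AddCon.add _ (h₁.2 (by omega)) (h₂.2 (by omega)) }
  have hle : AddCon.ker (Finsupp.weight a) ≤ D := by
    rw [← show addConGen (fun u v => (u, v) ∈ ρ) = _ from h, AddCon.addConGen_le]
    intro u v huv
    refine ⟨h.weight_eq huv, fun hw => AddConGen.Rel.of _ _ ⟨huv, ?_⟩⟩
    rintro rfl
    exact lt_irrefl _ hw
  exact (hle (show AddCon.ker (Finsupp.weight a) u v from huv)).2 hlt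

/-- The homomorphism from the polynomial ring to the algebra of the quotient of the monoid of
monomials by a congruence. -/
noncomputable def toConAlgebra (k : Type*) [Field k] (c : AddCon (Fin e →₀ ℕ)) :
    MvPolynomial (Fin e) k →ₐ[k] AddMonoidAlgebra k c.Quotient :=
  aeval fun i => AddMonoidAlgebra.of k c.Quotient (Multiplicative.ofAdd (c.mk' (Finsupp.single i 1)))

theorem toConAlgebra_monomial (c : AddCon (Fin e →₀ ℕ)) (u : Fin e →₀ ℕ) (x : k) :
    toConAlgebra k c (monomial u x) = AddMonoidAlgebra.single (c.mk' u) x := by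
  have h1 : toConAlgebra k c (monomial u 1) =
      AddMonoidAlgebra.of k c.Quotient (Multiplicative.ofAdd (c.mk' u)) := by
    induction u using Finsupp.induction_linear with
    | zero =>
      rw [show monomial (0 : Fin e →₀ ℕ) (1 : k) = 1 from rfl, map_one, map_zero, ofAdd_zero,
        map_one]
    | add u v hu hv =>
      rw [← one_mul (1 : k), ← monomial_mul, map_mul, hu, hv, map_add, ofAdd_add, map_mul]
    | single i n =>
      rw [← X_pow_eq_monomial, map_pow, toConAlgebra, aeval_X, ← map_pow, ← ofAdd_nsmul,
        ← map_nsmul, Finsupp.smul_single, smul_eq_mul, mul_one]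
  have h2 : monomial u x = x • monomial u (1 : k) := by simp [smul_monomial]
  rw [h2, map_smul, h1]
  simp

/-- The weight of every relation in a minimal presentation is bounded by the degree of some
generator of the kernel ideal. -/
theorem IsMinimalPresentation.exists_weight_le (h : IsMinimalPresentation a ρ)
    {r : (Fin e →₀ ℕ) × (Fin e →₀ ℕ)} (hr : r ∈ ρ) {ι : Type*}
    (f : ι → MvPolynomial (Fin e) k) (d : ι → ℕ) (hf : ∀ i, IsWeightedHomogeneous a (f i) (d i))
    (hspan : Ideal.span (Set.range f) = RingHom.ker (semigroupRingHom k a)) :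
    ∃ i, Finsupp.weight a r.1 ≤ d i := by
  classical
  by_contra! hlt
  have hpres : IsPresentation a ρ := h.1
  set c := addConGen (fun u v => (u, v) ∈ ρ \ {r}) with hc
  -- All monomials of `f i` have weight below `|r|`, so `c` identifies them, and the coefficients
  -- sum to zero. The binomial of `r` then dies too, which forces `c r.1 r.2`.
  have hker : RingHom.ker (semigroupRingHom k a) ≤ RingHom.ker (toConAlgebra k c) := by
    rw [← hspan, Ideal.span_le]
    rintro _ ⟨i, rfl⟩
    have hsum : ∑ u ∈ (f i).support, (f i).coeff u = 0 := by
      have : f i ∈ RingHom.ker (semigroupRingHom k a) := hspan ▸ Ideal.subset_span ⟨i, rfl⟩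
      rw [RingHom.mem_ker, semigroupRingHom_of_isWeightedHomogeneous (hf i)] at this
      exact (Polynomial.monomial_eq_zero_iff _ _).1 this
    rw [SetLike.mem_coe, RingHom.mem_ker]
    rcases (f i).support.eq_empty_or_nonempty with h0 | ⟨u₀, hu₀⟩
    · rw [support_eq_empty.1 h0, map_zero]
    · rw [(f i).as_sum, map_sum]
      have hall : ∀ u ∈ (f i).support, toConAlgebra k c (monomial u ((f i).coeff u)) =
          AddMonoidAlgebra.single (c.mk' u₀) ((f i).coeff u) := by
        intro u hu
        rw [toConAlgebra_monomial]
        congr 1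
        have hwu := hf i (mem_support_iff.1 hu)
        have hwu₀ := hf i (mem_support_iff.1 hu₀)
        exact (AddCon.eq c).2 (hpres.addConGen_diff_of_weight_lt (hwu.trans hwu₀.symm)
          (by rw [hwu]; exact hlt i))
      rw [Finset.sum_congr rfl hall]
      have hmap := map_sum (AddMonoidAlgebra.singleAddHom (c.mk' u₀)) (fun u => (f i).coeff u)
        (f i).support
      rw [hsum, map_zero] at hmap
      exact hmap.symm
  have hrc : c r.1 r.2 := by
    have hmem : monomial r.1 (1 : k) - monomial r.2 1 ∈ RingHom.ker (semigroupRingHom k a) := by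
      rw [RingHom.mem_ker, map_sub, semigroupRingHom_monomial, semigroupRingHom_monomial,
        hpres.weight_eq hr, sub_self]
    have := hker hmem
    rw [RingHom.mem_ker, map_sub, toConAlgebra_monomial, toConAlgebra_monomial, sub_eq_zero] at this
    exact (AddCon.eq c).1 (AddMonoidAlgebra.of_injective (R := k) (M := c.Quotient) this)
  have hpres' : IsPresentation a (ρ \ {r}) := by
    refine le_antisymm ?_ ?_
    · rw [AddCon.addConGen_le]
      intro u v huv
      exact hpres.weight_eq huv.1
    · rw [← show addConGen (fun u v => (u, v) ∈ ρ) = _ from hpres, AddCon.addConGen_le]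
      intro u v huv
      by_cases hne : (u, v) = r
      · subst hne
        exact hrc
      · exact AddConGen.Rel.of _ _ ⟨huv, hne⟩
  exact (h.2 hpres' Set.sdiff_subset hr).2 rfl

end Presentation

/-! ### Summation over thresholds -/

section Counting

/-- If for every threshold at least as many `d i / 2` as `b j` reach it, then
twice the sum of the `b j` is at most the sum of the `d i`. -/
theorem two_mul_sum_le_sum_of_card_le {ι κ : Type*} (s : Finset ι) (t : Finset κ) (d : ι → ℕ)
    (b : κ → ℕ) (h : ∀ c, 0 < c → (t.filter fun j => c ≤ b j).card ≤
      (s.filter fun i => 2 * c ≤ d i).card) :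
    2 * ∑ j ∈ t, b j ≤ ∑ i ∈ s, d i := by
  classical
  obtain ⟨N, hN⟩ : ∃ N, (∀ i ∈ s, d i ≤ N) ∧ ∀ j ∈ t, b j ≤ N :=
    ⟨∑ i ∈ s, d i + ∑ j ∈ t, b j,
      fun i hi => (Finset.single_le_sum (fun _ _ => Nat.zero_le _) hi).trans (Nat.le_add_right _ _),
      fun j hj => (Finset.single_le_sum (fun _ _ => Nat.zero_le _) hj).trans (Nat.le_add_left _ _)⟩
  have layer : ∀ x ≤ N, ((Finset.Icc 1 N).filter fun c => c ≤ x).card = x := by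
    intro x hx
    have : ((Finset.Icc 1 N).filter fun c => c ≤ x) = Finset.Icc 1 x := by
      ext c
      simp only [Finset.mem_filter, Finset.mem_Icc]
      omega
    rw [this, Nat.card_Icc, Nat.add_sub_cancel]
  -- Each `b j` is the number of thresholds `c ≥ 1` it reaches; the double count is then reversed,
  -- likewise for `d i / 2`.
  have h1 : ∑ j ∈ t, b j = ∑ c ∈ Finset.Icc 1 N, (t.filter fun j => c ≤ b j).card := by
    refine Eq.trans ?_
      (Finset.sum_card_bipartiteAbove_eq_sum_card_bipartiteBelow fun j c => c ≤ b j)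
    exact Finset.sum_congr rfl fun j hj => (layer _ (hN.2 j hj)).symm
  have h2 : ∑ i ∈ s, d i / 2 = ∑ c ∈ Finset.Icc 1 N, (s.filter fun i => 2 * c ≤ d i).card := by
    refine Eq.trans ?_
      (Finset.sum_card_bipartiteAbove_eq_sum_card_bipartiteBelow fun i c => 2 * c ≤ d i)
    refine Finset.sum_congr rfl fun i hi => ?_
    refine (layer (d i / 2) ((Nat.div_le_self _ _).trans (hN.1 i hi))).symm.trans
      (congrArg Finset.card ?_)
    ext c
    simp only [Finset.mem_filter, Finset.bipartiteAbove, Finset.mem_Icc]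
    omega
  calc 2 * ∑ j ∈ t, b j ≤ 2 * ∑ i ∈ s, d i / 2 := by
        rw [h1, h2]
        exact Nat.mul_le_mul_left _ (Finset.sum_le_sum fun c hc => h c (Finset.mem_Icc.1 hc).1)
    _ = ∑ i ∈ s, 2 * (d i / 2) := Finset.mul_sum ..
    _ ≤ _ := Finset.sum_le_sum fun i _ => Nat.mul_div_le _ _

end Counting

/-! ### Two generators -/

section EmbeddingDimensionTwo

theorem Finsupp.weight_fin_two (a : Fin 2 → ℕ) (u : Fin 2 →₀ ℕ) :
    Finsupp.weight a u = u 0 * a 0 + u 1 * a 1 := by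
  rw [Finsupp.weight_apply, Finsupp.sum_fintype _ _ (by simp), Fin.sum_univ_two]
  rfl

theorem range_fin_two (a : Fin 2 → ℕ) : Set.range a = {a 0, a 1} := by
  ext x
  simp [Fin.exists_fin_two, eq_comm]

variable {S : NumericalSemigroup} {a : Fin 2 → ℕ}

theorem NumericalSemigroup.IsMinimallyGeneratedBy.coprime (h : S.IsMinimallyGeneratedBy a) :
    Nat.Coprime (a 0) (a 1) := by
  obtain ⟨B, hB⟩ := S.finite_compl.bddAbove
  have hmem : ∀ n, B < n → (a 0).gcd (a 1) ∣ n := by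
    intro n hn
    have hnS : n ∈ S.toAddSubmonoid := by
      by_contra hnot
      exact absurd (hB (show n ∈ (S.carrierᶜ : Set ℕ) from hnot)) (not_le.2 hn)
    rw [← h.1] at hnS
    obtain ⟨u, rfl⟩ := mem_closure_range_iff.1 hnS
    rw [Finsupp.weight_fin_two]
    exact dvd_add (Dvd.dvd.mul_left (Nat.gcd_dvd_left _ _) _)
      (Dvd.dvd.mul_left (Nat.gcd_dvd_right _ _) _)
  have := (Nat.dvd_add_right (hmem (B + 1) (by omega))).1 (hmem (B + 1 + 1) (by omega))
  exact Nat.dvd_one.1 this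

theorem NumericalSemigroup.IsMinimallyGeneratedBy.one_lt (h : S.IsMinimallyGeneratedBy a)
    (i : Fin 2) : 1 < a i := by
  have hpos := h.pos i
  by_contra! hle
  obtain ⟨j, hj⟩ : ∃ j, j ≠ i := exists_ne i
  refine h.notMem_closure j ?_
  have hmem : a i ∈ AddSubmonoid.closure (a '' {l | l ≠ j}) :=
    AddSubmonoid.subset_closure ⟨i, hj.symm, rfl⟩
  have := AddSubmonoid.nsmul_mem _ hmem (a j)
  rwa [show a i = 1 by omega, smul_eq_mul, mul_one] at this

theorem NumericalSemigroup.IsMinimallyGeneratedBy.frobenius_eq (h : S.IsMinimallyGeneratedBy a) :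
    S.frobenius = a 0 * a 1 - a 0 - a 1 := by
  have h0 := h.one_lt 0
  have h1 := h.one_lt 1
  have hfr := frobeniusNumber_iff.1 (frobeniusNumber_pair h.coprime h0 h1)
  rw [← range_fin_two, h.1] at hfr
  have hle : a 0 + a 1 ≤ a 0 * a 1 := Nat.add_le_mul h0 h1
  have hcast : ((a 0 * a 1 - a 0 - a 1 : ℕ) : ℤ) = a 0 * a 1 - a 0 - a 1 := by
    rw [Nat.sub_sub, Nat.cast_sub hle]
    push_cast
    ring
  rw [← hcast]
  refine S.isGreatest_frobenius.unique ⟨?_, ?_⟩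
  · rintro ⟨s, hs, hsn⟩
    exact hfr.1 ((by exact_mod_cast hsn : s = _) ▸ hs)
  · intro n hn
    by_contra! hlt
    refine hn ⟨n.toNat, hfr.2 _ (by omega), by omega⟩

/-- By coprimality, vectors of equal weight differ by a multiple of `(a 1, -a 0)`. This presentation
witnesses the failure of Condition (*) in the exceptional cases. -/
theorem isMinimalPresentation_fin_two (h : S.IsMinimallyGeneratedBy a) :
    IsMinimalPresentation a {(Finsupp.single 0 (a 1), Finsupp.single 1 (a 0))} := by
  have h0 := h.pos 0
  have h1 := h.pos 1
  refine ⟨le_antisymm ?_ ?_, ?_⟩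
  · rw [AddCon.addConGen_le]
    intro u v huv
    obtain ⟨rfl, rfl⟩ := Prod.mk.inj (Set.mem_singleton_iff.1 huv)
    change Finsupp.weight a _ = Finsupp.weight a _
    rw [Finsupp.weight_single, Finsupp.weight_single, smul_eq_mul, smul_eq_mul, mul_comm]
  · set c := addConGen fun u v => (u, v) ∈
      ({(Finsupp.single 0 (a 1), Finsupp.single 1 (a 0))} :
        Set ((Fin 2 →₀ ℕ) × (Fin 2 →₀ ℕ))) with hc
    have hrel : c (Finsupp.single 0 (a 1)) (Finsupp.single 1 (a 0)) :=
      AddConGen.Rel.of _ _ (Set.mem_singleton _)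
    have key : ∀ u v : Fin 2 →₀ ℕ, Finsupp.weight a u = Finsupp.weight a v → v 0 ≤ u 0 →
        c u v := by
      intro u v huv hle
      rw [Finsupp.weight_fin_two, Finsupp.weight_fin_two] at huv
      obtain ⟨p, hp⟩ := Nat.exists_eq_add_of_le hle
      have hle1 : u 1 ≤ v 1 := by
        by_contra! hlt
        have h2 := Nat.mul_le_mul_right (a 0) hle
        have h3 := Nat.mul_lt_mul_of_pos_right hlt h1
        omega
      obtain ⟨q, hq⟩ := Nat.exists_eq_add_of_le hle1
      have hpq : p * a 0 = q * a 1 := by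
        rw [hp, hq] at huv
        nlinarith
      obtain ⟨m, rfl⟩ : a 1 ∣ p := h.coprime.symm.dvd_of_dvd_mul_right ⟨q, by rw [hpq, mul_comm]⟩
      have hqm : q = a 0 * m := by
        have : (a 0 * m) * a 1 = q * a 1 := by rw [← hpq]; ring
        exact (Nat.eq_of_mul_eq_mul_right h1 this).symm
      have hu : u = m • Finsupp.single 0 (a 1) +
          (Finsupp.single 0 (v 0) + Finsupp.single 1 (u 1)) := by
        ext i
        fin_cases i
        · simp [hp]; ring
        · simp
      have hv : v = m • Finsupp.single 1 (a 0) +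
          (Finsupp.single 0 (v 0) + Finsupp.single 1 (u 1)) := by
        ext i
        fin_cases i
        · simp
        · simp [hq, hqm]; ring
      rw [hu]
      conv => arg 3; rw [hv]
      exact c.add (c.nsmul m hrel) (c.refl _)
    intro u v huv
    have huv' : Finsupp.weight a u = Finsupp.weight a v := huv
    rcases le_total (v 0) (u 0) with hle | hle
    · exact key u v huv' hle
    · exact c.symm (key v u huv'.symm hle)
  · intro ρ hρ hsub
    rcases Set.subset_singleton_iff_eq.1 hsub with rfl | rfl
    · exfalso
      have hbot : addConGen (fun u v => (u, v) ∈ (∅ : Set ((Fin 2 →₀ ℕ) × (Fin 2 →₀ ℕ)))) ≤ ⊥ := by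
        rw [AddCon.addConGen_le]
        intro u v huv
        exact absurd huv (Set.notMem_empty _)
      rw [show addConGen _ = _ from hρ] at hbot
      have hker : AddCon.ker (Finsupp.weight a) (Finsupp.single 0 (a 1))
          (Finsupp.single 1 (a 0)) := by
        change Finsupp.weight a _ = Finsupp.weight a _
        rw [Finsupp.weight_single, Finsupp.weight_single, smul_eq_mul, smul_eq_mul, mul_comm]
      have heq : Finsupp.single (0 : Fin 2) (a 1) = Finsupp.single 1 (a 0) := hbot hker
      have := DFunLike.congr_fun heq 0
      simp at this
      omega
    · exact le_rfl

end EmbeddingDimensionTwo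

/-! ### The inequality for three or more generators, and the exceptional cases -/

section Main

open MvPolynomial

variable {k : Type*} [Field k] {S : NumericalSemigroup}

theorem satisfiesConditionStar_of_three_le {e : ℕ} {a : Fin e → ℕ} (he : 3 ≤ e)
    (h : S.IsMinimallyGeneratedBy a) (hci : IsCompleteIntersectionSemigroupRing k a) :
    S.SatisfiesConditionStar a := by
  classical
  obtain ⟨f, hf, hreg, hspan⟩ := hci
  choose d hf using hf
  have hker : ∀ i, f i ∈ RingHom.ker (semigroupRingHom k a) := fun i =>
    hspan ▸ Ideal.subset_span ⟨i, rfl⟩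
  have : Nonempty (Fin e) := ⟨⟨0, by omega⟩⟩
  obtain ⟨j₀, hj₀⟩ := Finite.exists_min a
  have hlt : ∀ j ∈ Finset.univ.erase j₀, a j₀ + 1 ≤ a j := fun j hj =>
    lt_of_le_of_ne (hj₀ j) fun heq => (Finset.ne_of_mem_erase hj) (h.injective heq).symm
  have hcount : ∀ c, ((Finset.univ.erase j₀).filter fun j => c ≤ a j).card ≤
      (Finset.univ.filter fun i => 2 * c ≤ d i).card := by
    intro c
    have hnot : j₀ ∉ (Finset.univ.erase j₀).filter fun j => c ≤ a j := by simp
    refine (card_le_card_notMem_span_X h.pos hspan hnot).trans (Finset.card_le_card ?_)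
    intro i hi
    rw [Finset.mem_filter] at hi ⊢
    exact ⟨Finset.mem_univ _, two_mul_le_of_notMem_span_X h (hf i) (hker i)
      (fun j hj => (Finset.mem_filter.1 hj).2) hi.2⟩
  -- At the threshold `a j₀ + 1` all `e - 1` remaining generators count, hence so do all `e - 1`
  -- relations.
  have hdi : ∀ i, 2 * (a j₀ + 1) ≤ d i := by
    have h1 := hcount (a j₀ + 1)
    rw [Finset.filter_true_of_mem hlt, Finset.card_erase_of_mem (Finset.mem_univ _),
      Finset.card_univ, Fintype.card_fin] at h1
    have h2 : (Finset.univ.filter fun i => 2 * (a j₀ + 1) ≤ d i) = Finset.univ := by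
      apply Finset.eq_univ_of_card
      rw [Fintype.card_fin]
      refine le_antisymm ?_ h1
      exact (Finset.card_le_univ _).trans (by simp)
    intro i
    have := Finset.mem_univ i
    rw [← h2] at this
    exact (Finset.mem_filter.1 this).2
  have hsum := two_mul_sum_le_sum_of_card_le Finset.univ (Finset.univ.erase j₀) d a
    fun c _ => hcount c
  have hfrob := sum_degree_le_frobenius_add S h.pos h.1 f d hf
    (fun i => by have := hdi i; omega) hreg hspan
  intro ρ hρ r hr
  obtain ⟨i₀, hi₀⟩ := hρ.exists_weight_le hr f d hf hspan
  -- Here `3 ≤ e` is essential: the second relation outweighs the term `2 * a j₀`.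
  obtain ⟨i₁, hi₁⟩ : ∃ i₁ : Fin (e - 1), i₁ ≠ i₀ := by
    have : Nontrivial (Fin (e - 1)) := Fin.nontrivial_iff_two_le.2 (by omega)
    exact exists_ne i₀
  have hpair : d i₀ + d i₁ ≤ ∑ i, d i := by
    rw [← Finset.add_sum_erase _ d (Finset.mem_univ i₀)]
    exact Nat.add_le_add_left (Finset.single_le_sum (f := d) (fun _ _ => Nat.zero_le _)
      (Finset.mem_erase.2 ⟨hi₁, Finset.mem_univ _⟩)) _
  have hsplit := Finset.add_sum_erase _ a (Finset.mem_univ j₀)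
  have hd₁ := hdi i₁
  have hgoal : (Finsupp.weight a r.1 : ℤ) < 2 * S.frobenius := by omega
  have hgoal' : ((Finsupp.weight a r.1 : ℕ) : ℚ) < 2 * (S.frobenius : ℚ) := by exact_mod_cast hgoal
  linarith

theorem satisfiesConditionStar_fin_two_iff {a : Fin 2 → ℕ} (h : S.IsMinimallyGeneratedBy a)
    (hci : IsCompleteIntersectionSemigroupRing k a) :
    S.SatisfiesConditionStar a ↔ 2 * a 0 + 2 * a 1 < a 0 * a 1 := by
  have hF := h.frobenius_eq
  constructor
  · intro hstar
    have h1 := hstar _ (isMinimalPresentation_fin_two h) _ (Set.mem_singleton _)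
    rw [hF, Finsupp.weight_single, smul_eq_mul] at h1
    push_cast at h1
    have h2 : (2 * a 0 + 2 * a 1 : ℚ) < a 0 * a 1 := by nlinarith
    exact_mod_cast h2
  · intro hlt ρ hρ r hr
    obtain ⟨f, hf, hreg, hspan⟩ := hci
    choose d hf using hf
    obtain ⟨i, hi⟩ := hρ.exists_weight_le hr f d hf hspan
    have hker : ∀ i, f i ∈ RingHom.ker (semigroupRingHom k a) := fun i =>
      hspan ▸ Ideal.subset_span ⟨i, rfl⟩
    have hpos : ∀ i, 0 < d i := by
      intro i
      by_contra! h0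
      have hd0 : d i = 0 := Nat.le_zero.1 h0
      obtain ⟨m, hm⟩ := support_nonempty.2 (ne_zero_of_isRegular hreg i)
      have h2 := two_le_degree_of_mem_support h (hf i) (hker i) hm
      have hw := hf i (mem_support_iff.1 hm)
      have := Finsupp.nonTorsionWeight_of (R := ℕ) (w := a) fun i => (h.pos i).ne'
      rw [hd0, Finsupp.weight_eq_zero_iff_eq_zero a] at hw
      rw [hw, map_zero] at h2
      omega
    have hfrob := sum_degree_le_frobenius_add S h.pos h.1 f d hf hpos hreg hspan
    have hdi : d i ≤ ∑ i, d i := Finset.single_le_sum (fun _ _ => Nat.zero_le _) (Finset.mem_univ i)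
    rw [hF, Fin.sum_univ_two a] at hfrob
    have h3 : (Finsupp.weight a r.1 : ℤ) ≤ a 0 * a 1 := by
      push_cast at hfrob
      have : ((Finsupp.weight a r.1 : ℕ) : ℤ) ≤ ((∑ i, d i : ℕ) : ℤ) := by
        exact_mod_cast hi.trans hdi
      push_cast at this
      linarith
    have h4 : ((Finsupp.weight a r.1 : ℕ) : ℚ) ≤ a 0 * a 1 := by exact_mod_cast h3
    have h5 : (2 * a 0 + 2 * a 1 : ℚ) < a 0 * a 1 := by exact_mod_cast hlt
    rw [hF]
    push_cast
    linarith

theorem two_mul_add_lt_mul_iff {m n : ℕ} (hmn : m.Coprime n) (hm : 1 < m) (hn : 1 < n) :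
    2 * m + 2 * n < m * n ↔
      ¬ (m = 2 ∨ n = 2 ∨ ({m, n} : Set ℕ) = {3, 4} ∨ ({m, n} : Set ℕ) = {3, 5}) := by
  have hpair : ∀ x y : ℕ, ({m, n} : Set ℕ) = {x, y} ↔ (m = x ∧ n = y) ∨ (m = y ∧ n = x) :=
    fun x y => Set.pair_eq_pair_iff
  rw [hpair, hpair]
  constructor
  · intro h
    rintro (rfl | rfl | (⟨rfl, rfl⟩ | ⟨rfl, rfl⟩) | ⟨rfl, rfl⟩ | ⟨rfl, rfl⟩) <;> omega
  · intro h
    by_contra! hle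
    have hm3 : 3 ≤ m := by omega
    have hn3 : 3 ≤ n := by omega
    -- The negated inequality reads `(m - 2) * (n - 2) ≤ 4`, with both factors at least `1`.
    have hm6 : m ≤ 6 := by nlinarith
    have hn6 : n ≤ 6 := by nlinarith
    clear hpair
    interval_cases m <;> interval_cases n <;> first | omega | exact absurd hmn (by decide)

end Main

theorem proposition4p9 {k : Type*} [Field k] (S : NumericalSemigroup) {e : ℕ} (a : Fin e → ℕ)
    (hgen : S.IsMinimallyGeneratedBy a) (hci : IsCompleteIntersectionSemigroupRing k a) :
    S.SatisfiesConditionStar a ↔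
      ¬ (e = 2 ∧ (2 ∈ Set.range a ∨ Set.range a = {3, 4} ∨ Set.range a = {3, 5})) := by
  rcases Nat.lt_or_ge 2 e with he | he
  · exact iff_of_true (satisfiesConditionStar_of_three_le he hgen hci) fun h => by omega
  rcases he.eq_or_lt with rfl | he
  · rw [satisfiesConditionStar_fin_two_iff hgen hci,
      two_mul_add_lt_mul_iff hgen.coprime (hgen.one_lt 0) (hgen.one_lt 1), range_fin_two]
    simp [eq_comm, or_assoc]
  -- For `e ≤ 1` the index type `Fin (e - 1)` is empty, so no minimal presentation contains a
  -- relation.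
  · refine iff_of_true (fun ρ hρ r hr => ?_) fun h => by omega
    obtain ⟨f, hf, -, hspan⟩ := hci
    choose d hf using hf
    obtain ⟨i, -⟩ := hρ.exists_weight_le hr f d hf hspan
    exact absurd i.2 (by omega)
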